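/- Let $N\ge 2$, and let $A=(a_1,\dots,a_N)$ and $B=(b_1,\dots,b_N)$ be vectors in $\mathbb{R}^N$ with nonnegative entries. Put $a=a_1+\cdots+a_N$, $b=b_1+\cdots+b_N$, and $x^A=|x_1|^{a_1}\cdots|x_N|^{a_N}$, $x^B=|x_1|^{b_1}\cdots|x_N|^{b_N}$ for $x\in\mathbb{R}^N$. Define $$C_{A,B,N}:=\inf\left\{\frac{\int_{\partial\Omega}x^{A}\,d\mathcal{H}^{N-1}(x)}{\left[\int_{\Omega}x^{B}\,dx\right]^{\frac{N+a-1}{N+b}}}\;:\;\Omega\subset\mathbb{R}^N\text{ is a smooth open set with } 0<\int_{\Omega}x^{B}\,dx<\infty\right\},$$ where $\mathcal{H}^{N-1}$ is the $(N-1)$-dimensional Hausdorff measure (normalized so as to agree with surface area), and an open set $\Omega$ is smooth if near each point $p$ of $\partial\Omega$ it coincides with $\{\varphi<0\}$ for some $C^\infty$ function $\varphi$ with $\nabla\varphi(p)\ne 0$. Suppose that for some $i\in\{1,\dots,N\}$ we have $a_j=b_j$ for all $j\ne i$ and $a_i=b_i+1$. Then $$C_{A,B,N}=a_i .$$ -/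

import Mathlib

open scoped MeasureTheory ENNReal ContDiff

noncomputable section

namespace MonomialIsoperimetry

/-- The monomial weight `x^A = |x₁|^{a₁} ⋯ |x_N|^{a_N}`, as an extended nonnegative real
(for integration with the Lebesgue integral of nonnegative functions). -/
def weight {N : ℕ} (A : Fin N → ℝ) (x : EuclideanSpace ℝ (Fin N)) : ℝ≥0∞ :=
  ENNReal.ofReal (∏ j, |x j| ^ A j)

/-- A smooth open set: an open set `Ω` which near each of its boundary points `p` is the
negativity set `{φ < 0}` of a `C^∞` function `φ` whose differential at `p` does not vanish.
(By the implicit function theorem, `∂Ω` is then near `p` a smooth hypersurface, and `Ω` lies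
locally on one side of it.) -/
def IsSmoothOpen {N : ℕ} (Ω : Set (EuclideanSpace ℝ (Fin N))) : Prop :=
  IsOpen Ω ∧ ∀ p ∈ frontier Ω, ∃ (U : Set (EuclideanSpace ℝ (Fin N)))
    (φ : EuclideanSpace ℝ (Fin N) → ℝ),
      IsOpen U ∧ p ∈ U ∧ ContDiffOn ℝ ∞ φ U ∧ fderiv ℝ φ p ≠ 0 ∧
      ∀ x ∈ U, (x ∈ Ω ↔ φ x < 0)

/-- The weighted volume `m_B(Ω) = ∫_Ω x^B dx`. -/
def weightedVolume {N : ℕ} (B : Fin N → ℝ) (Ω : Set (EuclideanSpace ℝ (Fin N))) : ℝ≥0∞ :=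
  ∫⁻ x in Ω, weight B x

/-- The weighted perimeter `P_A(Ω) = ∫_{∂Ω} x^A dℋ^{N-1}`. Here `μHE[d]` is Mathlib's
`d`-dimensional Hausdorff measure, normalized to agree with Lebesgue measure on `ℝ^d`. -/
def weightedPerimeter {N : ℕ} (A : Fin N → ℝ) (Ω : Set (EuclideanSpace ℝ (Fin N))) : ℝ≥0∞ :=
  ∫⁻ x in frontier Ω, weight A x ∂μHE[N - 1]

/-- The isoperimetric quotient `P_A(Ω) / m_B(Ω)^{(N+a-1)/(N+b)}`, where `a = ∑ⱼ aⱼ` and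
`b = ∑ⱼ bⱼ`. -/
def quotient {N : ℕ} (A B : Fin N → ℝ) (Ω : Set (EuclideanSpace ℝ (Fin N))) : ℝ≥0∞ :=
  weightedPerimeter A Ω /
    weightedVolume B Ω ^ (((N : ℝ) + ∑ j, A j - 1) / ((N : ℝ) + ∑ j, B j))

/-- The isoperimetric constant `C_{A,B,N}`: the infimum of the quotient over all smooth open
sets `Ω` with `0 < ∫_Ω x^B dx < ∞`. -/
def isoConst {N : ℕ} (A B : Fin N → ℝ) : ℝ≥0∞ :=
  sInf {q | ∃ Ω : Set (EuclideanSpace ℝ (Fin N)), IsSmoothOpen Ω ∧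
    0 < weightedVolume B Ω ∧ weightedVolume B Ω < ⊤ ∧ q = quotient A B Ω}

end MonomialIsoperimetry

end

namespace MonomialIsoperimetry
open MeasureTheory Set

/-! ### One-dimensional weights -/

/-! Since `a = b + 1` for the total exponents, the power of the volume is 1 and the quotient is `P_A
/ m_B`.

Lower bound: slice by lines parallel to the `i`-th axis and treat the half-spaces `x_i > 0` and `x_i
< 0` separately. On a half-line, an open set `O` of finite weighted length satisfies `a_i ∫_O
|t|^(a_i - 1) ≤ sup |t|^(a_i)` over its frontier points there (`exists_frontier_pos`). Thus
superlevel sets of the sliced volume lie in projections of superlevel sets of the weight on the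
frontier. Projection does not increase Hausdorff measure, so the layer-cake formula integrates this
(`lintegral_le_of_forall_exists_fiber`).

Upper bound: the domain `|x_i| < δ exp(-|y|²)` is bounded by two graphs of slope at most `δ`, so its
quotient is at most `(1 + δ)^(N-1) a_i`. Let `δ → 0`. -/

theorem lintegral_Ioc_rpow {a r : ℝ} (ha : 1 ≤ a) (hr : 0 ≤ r) :
    ENNReal.ofReal a * ∫⁻ t in Ioc 0 r, ENNReal.ofReal (|t| ^ (a - 1)) =
      ENNReal.ofReal (r ^ a) := by
  have h1 : ∫⁻ t in Ioc 0 r, ENNReal.ofReal (|t| ^ (a - 1)) =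
      ∫⁻ t in Ioc 0 r, ENNReal.ofReal (t ^ (a - 1)) :=
    setLIntegral_congr_fun measurableSet_Ioc fun t ht => by simp only [abs_of_pos ht.1]
  have hint : IntervalIntegrable (fun t : ℝ => t ^ (a - 1)) volume 0 r :=
    intervalIntegral.intervalIntegrable_rpow' (by linarith)
  rw [h1, ← ofReal_integral_eq_lintegral_ofReal
    ((intervalIntegrable_iff_integrableOn_Ioc_of_le hr).1 hint)
    ((ae_restrict_iff' measurableSet_Ioc).2 (.of_forall fun t ht => Real.rpow_nonneg ht.1.le _)),
    ← intervalIntegral.integral_of_le hr, integral_rpow (Or.inl (by linarith)),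
    ← ENNReal.ofReal_mul (by linarith)]
  congr 1
  rw [sub_add_cancel, Real.zero_rpow (by linarith)]
  field_simp
  ring

theorem lintegral_Ioi_rpow_eq_top {a r : ℝ} (ha : 1 ≤ a) :
    ∫⁻ t in Ioi r, ENNReal.ofReal (|t| ^ (a - 1)) = ⊤ := by
  rw [eq_top_iff]
  calc (⊤ : ℝ≥0∞) = ∫⁻ t in Ioi (max r 1), 1 := by simp
    _ ≤ ∫⁻ t in Ioi (max r 1), ENNReal.ofReal (|t| ^ (a - 1)) := by
      refine setLIntegral_mono' measurableSet_Ioi fun t ht => ?_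
      have ht1 : 1 < t := (le_max_right r 1).trans_lt ht
      rw [ENNReal.one_le_ofReal]
      exact Real.one_le_rpow (by rw [abs_of_pos (by linarith)]; exact ht1.le) (by linarith)
    _ ≤ _ := lintegral_mono_set (Ioi_subset_Ioi (le_max_left r 1))

theorem _root_.IsPreconnected.subset_or_disjoint_of_disjoint_frontier {X : Type*}
    [TopologicalSpace X] {s t : Set X} (hs : IsPreconnected s) (ht : IsOpen t)
    (hd : Disjoint s (frontier t)) : s ⊆ t ∨ Disjoint s t := by
  have hcov : s ⊆ t ∪ (closure t)ᶜ := fun x hx => by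
    by_contra hcon
    simp only [mem_union, mem_compl_iff, not_or, not_not] at hcon
    exact hd.le_bot ⟨hx, by rw [ht.frontier_eq]; exact ⟨hcon.2, hcon.1⟩⟩
  rcases hs.subset_or_subset ht isClosed_closure.isOpen_compl
    (disjoint_compl_right.mono_left subset_closure) hcov with h | h
  · exact Or.inl h
  · exact Or.inr ((disjoint_compl_left.mono_right subset_closure).mono_left h)

/-- Otherwise the ray beyond `r = s ^ a⁻¹` misses the frontier, so it is inside `O` or disjoint from
`O`. The first contradicts finiteness; the second puts the positive part of `O` in `(0, r]`, whose
weighted length times `a` is `r ^ a = s`. -/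
theorem exists_frontier_pos {a : ℝ} (ha : 1 ≤ a) {O : Set ℝ} (hO : IsOpen O) {s : ℝ} (hs : 0 ≤ s)
    (hfin : ∫⁻ t in O ∩ Ioi 0, ENNReal.ofReal (|t| ^ (a - 1)) ≠ ⊤)
    (hlt : ENNReal.ofReal s <
      ENNReal.ofReal a * ∫⁻ t in O ∩ Ioi 0, ENNReal.ofReal (|t| ^ (a - 1))) :
    ∃ t ∈ frontier O, t ∈ Ioi (0 : ℝ) ∧ s < |t| ^ a := by
  by_contra! hcon
  have hr : 0 ≤ s ^ a⁻¹ := Real.rpow_nonneg hs _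
  have hra : (s ^ a⁻¹) ^ a = s := Real.rpow_inv_rpow hs (by linarith)
  have hd : Disjoint (Ioi (s ^ a⁻¹)) (frontier O) := by
    rw [disjoint_left]
    intro t ht htO
    have ht0 : 0 < t := hr.trans_lt ht
    have := hcon t htO ht0
    rw [abs_of_pos ht0] at this
    have h2 := Real.rpow_lt_rpow hr (show s ^ a⁻¹ < t from ht) (by linarith : 0 < a)
    rw [hra] at h2
    linarith
  rcases isPreconnected_Ioi.subset_or_disjoint_of_disjoint_frontier hO hd with h | h
  · refine hfin (eq_top_iff.2 ?_)
    rw [← lintegral_Ioi_rpow_eq_top (r := s ^ a⁻¹) ha]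
    exact lintegral_mono_set (subset_inter h (Ioi_subset_Ioi hr))
  · refine hlt.not_ge ?_
    rw [← hra, ← lintegral_Ioc_rpow ha hr]
    gcongr
    intro t ht
    exact ⟨ht.2, not_lt.1 fun hlt => h.le_bot ⟨hlt, ht.1⟩⟩

theorem setLIntegral_neg_preimage (a : ℝ) (O : Set ℝ) :
    ∫⁻ t in Neg.neg ⁻¹' O, ENNReal.ofReal (|t| ^ a) = ∫⁻ t in O, ENNReal.ofReal (|t| ^ a) := by
  have := (Measure.measurePreserving_neg (volume : Measure ℝ)).setLIntegral_comp_preimage_emb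
    (Homeomorph.neg ℝ).measurableEmbedding (fun t => ENNReal.ofReal (|t| ^ a)) O
  simpa using this

theorem exists_frontier_neg {a : ℝ} (ha : 1 ≤ a) {O : Set ℝ} (hO : IsOpen O) {s : ℝ} (hs : 0 ≤ s)
    (hfin : ∫⁻ t in O ∩ Iio 0, ENNReal.ofReal (|t| ^ (a - 1)) ≠ ⊤)
    (hlt : ENNReal.ofReal s <
      ENNReal.ofReal a * ∫⁻ t in O ∩ Iio 0, ENNReal.ofReal (|t| ^ (a - 1))) :
    ∃ t ∈ frontier O, t ∈ Iio (0 : ℝ) ∧ s < |t| ^ a := by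
  have hset : Neg.neg ⁻¹' (O ∩ Iio 0) = (Neg.neg ⁻¹' O) ∩ Ioi (0 : ℝ) := by
    ext t; simp
  rw [← setLIntegral_neg_preimage, hset] at hfin hlt
  obtain ⟨t, ht, ht0, hst⟩ := exists_frontier_pos ha (hO.preimage continuous_neg) hs hfin hlt
  have hfr : frontier (Neg.neg ⁻¹' O) = Neg.neg ⁻¹' frontier O :=
    ((Homeomorph.neg ℝ).preimage_frontier O).symm
  rw [hfr] at ht
  exact ⟨-t, ht, by simpa using ht0, by rwa [abs_neg]⟩

theorem lintegral_Ioo_neg_rpow {a r : ℝ} (ha : 1 ≤ a) (hr : 0 ≤ r) :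
    ENNReal.ofReal a * ∫⁻ t in Ioo (-r) r, ENNReal.ofReal (|t| ^ (a - 1)) =
      2 * ENNReal.ofReal (r ^ a) := by
  have hneg : ∫⁻ t in Ico (-r) 0, ENNReal.ofReal (|t| ^ (a - 1)) =
      ∫⁻ t in Ioc 0 r, ENNReal.ofReal (|t| ^ (a - 1)) := by
    rw [← setLIntegral_neg_preimage]
    congr 2
    ext t; simp [and_comm]
  have hsplit : ∫⁻ t in Ioo (-r) r, ENNReal.ofReal (|t| ^ (a - 1)) =
      ∫⁻ t in Ico (-r) 0 ∪ Ioc 0 r, ENNReal.ofReal (|t| ^ (a - 1)) := by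
    have h0 : (volume : Measure ℝ) {-r, 0, r} = 0 := (Set.toFinite _).measure_zero _
    refine setLIntegral_congr (ae_eq_set.2 ⟨measure_mono_null ?_ h0, measure_mono_null ?_ h0⟩)
    · intro t ht
      simp only [mem_sdiff, mem_Ioo, mem_union, mem_Ico, mem_Ioc, not_or, not_and, not_lt,
        not_le] at ht
      have : t = 0 := by
        rcases lt_trichotomy t 0 with h | h | h
        · linarith [ht.2.1 ht.1.1.le]
        · exact h
        · linarith [ht.2.2 h, ht.1.2]
      simp [this]
    · intro t ht
      simp only [mem_sdiff, mem_Ioo, mem_union, mem_Ico, mem_Ioc, not_and, not_lt] at ht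
      simp only [mem_insert_iff, mem_singleton_iff]
      by_contra! hc
      rcases ht with ⟨⟨h1, h2⟩ | ⟨h1, h2⟩, h3⟩
      · have h4 := h3 (lt_of_le_of_ne h1 hc.1.symm)
        linarith
      · have h4 := h3 (by linarith)
        exact hc.2.2 (le_antisymm h2 h4)
  rw [hsplit, lintegral_union measurableSet_Ioc, hneg, mul_add, lintegral_Ioc_rpow ha hr, two_mul]
  rw [disjoint_left]
  rintro t ⟨_, h⟩ ⟨h', _⟩
  exact lt_asymm h h'

/-! ### Splitting off a coordinate -/

/-- The point whose `i`-th coordinate is `p.1` and whose other coordinates are those of `p.2`. -/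
def insertCoord {n : ℕ} (i : Fin (n + 1)) (p : ℝ × EuclideanSpace ℝ (Fin n)) :
    EuclideanSpace ℝ (Fin (n + 1)) :=
  WithLp.toLp 2 (i.insertNth p.1 (WithLp.ofLp p.2))

/-- The projection of a point that forgets its `i`-th coordinate. -/
def removeCoord {n : ℕ} (i : Fin (n + 1)) (x : EuclideanSpace ℝ (Fin (n + 1))) :
    EuclideanSpace ℝ (Fin n) :=
  WithLp.toLp 2 fun j => x (i.succAbove j)

section Coordinates

variable {n : ℕ} (i : Fin (n + 1))

@[simp]
theorem insertCoord_same (p : ℝ × EuclideanSpace ℝ (Fin n)) : insertCoord i p i = p.1 := by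
  simp [insertCoord]

@[simp]
theorem insertCoord_succAbove (p : ℝ × EuclideanSpace ℝ (Fin n)) (j : Fin n) :
    insertCoord i p (i.succAbove j) = p.2 j := by
  simp [insertCoord]

@[simp]
theorem removeCoord_apply (x : EuclideanSpace ℝ (Fin (n + 1))) (j : Fin n) :
    removeCoord i x j = x (i.succAbove j) := rfl

@[simp]
theorem removeCoord_insertCoord (p : ℝ × EuclideanSpace ℝ (Fin n)) :
    removeCoord i (insertCoord i p) = p.2 := by
  ext j; simp

theorem insertCoord_removeCoord (x : EuclideanSpace ℝ (Fin (n + 1))) :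
    insertCoord i (x i, removeCoord i x) = x := by
  ext j
  rcases Fin.eq_self_or_eq_succAbove i j with rfl | ⟨k, rfl⟩ <;> simp

theorem continuous_insertCoord : Continuous (insertCoord i) := by
  refine (PiLp.continuous_toLp 2 _).comp (continuous_pi fun j => ?_)
  rcases Fin.eq_self_or_eq_succAbove i j with rfl | ⟨k, rfl⟩
  · simpa using continuous_fst
  · simp only [Fin.insertNth_apply_succAbove]
    fun_prop

theorem contDiff_removeCoord : ContDiff ℝ ∞ (removeCoord i) := by
  rw [contDiff_euclidean]
  intro j
  simp only [removeCoord_apply]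
  fun_prop

theorem norm_sq_eq_add_removeCoord (x : EuclideanSpace ℝ (Fin (n + 1))) :
    ‖x‖ ^ 2 = (x i) ^ 2 + ‖removeCoord i x‖ ^ 2 := by
  simp [EuclideanSpace.norm_sq_eq, Fin.sum_univ_succAbove _ i]

theorem lipschitzWith_removeCoord : LipschitzWith 1 (removeCoord i) := by
  refine LipschitzWith.of_dist_le_mul fun x y => ?_
  have h : removeCoord i x - removeCoord i y = removeCoord i (x - y) := by ext j; simp
  rw [NNReal.coe_one, one_mul, dist_eq_norm, dist_eq_norm, h]
  refine abs_le_of_sq_le_sq' ?_ (norm_nonneg _) |>.2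
  rw [norm_sq_eq_add_removeCoord i (x - y)]
  nlinarith [sq_nonneg ((x - y) i)]

theorem measurePreserving_insertCoord :
    MeasurePreserving (insertCoord i)
      ((volume : Measure ℝ).prod (volume : Measure (EuclideanSpace ℝ (Fin n)))) volume :=
  (PiLp.volume_preserving_toLp (Fin (n + 1))).comp
    (((volume_preserving_piFinSuccAbove (fun _ : Fin (n + 1) => ℝ) i).symm _).comp
      ((MeasurePreserving.id volume).prod (PiLp.volume_preserving_ofLp (Fin n))))

theorem lintegral_eq_lintegral_insertCoord {f : EuclideanSpace ℝ (Fin (n + 1)) → ℝ≥0∞}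
    (hf : Measurable f) : ∫⁻ x, f x = ∫⁻ y, ∫⁻ t, f (insertCoord i (t, y)) := by
  rw [← (measurePreserving_insertCoord i).lintegral_comp hf]
  exact lintegral_prod_symm' _ (hf.comp (continuous_insertCoord i).measurable)

theorem continuous_prod_abs_rpow {m : ℕ} {A : Fin m → ℝ} (hA : ∀ j, 0 ≤ A j) :
    Continuous fun x : EuclideanSpace ℝ (Fin m) => ∏ j, |x j| ^ A j := by
  refine continuous_finsetProd _ fun j _ => ?_
  exact (Real.continuous_rpow_const (hA j)).comp (by fun_prop)

theorem continuous_weight {m : ℕ} {A : Fin m → ℝ} (hA : ∀ j, 0 ≤ A j) :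
    Continuous (weight A) :=
  ENNReal.continuous_ofReal.comp (continuous_prod_abs_rpow hA)

theorem prod_abs_rpow_nonneg {m : ℕ} (A : Fin m → ℝ) (x : EuclideanSpace ℝ (Fin m)) :
    0 ≤ ∏ j, |x j| ^ A j :=
  Finset.prod_nonneg fun _ _ => Real.rpow_nonneg (abs_nonneg _) _

theorem prod_abs_rpow_insertCoord (A : Fin (n + 1) → ℝ) (t : ℝ) (y : EuclideanSpace ℝ (Fin n)) :
    ∏ j, |insertCoord i (t, y) j| ^ A j = |t| ^ A i * ∏ j, |y j| ^ A (i.succAbove j) := by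
  simp [Fin.prod_univ_succAbove _ i]

theorem weight_insertCoord (A : Fin (n + 1) → ℝ) (t : ℝ) (y : EuclideanSpace ℝ (Fin n)) :
    weight A (insertCoord i (t, y)) =
      ENNReal.ofReal (∏ j, |y j| ^ A (i.succAbove j)) * ENNReal.ofReal (|t| ^ A i) := by
  rw [weight, prod_abs_rpow_insertCoord, mul_comm, ENNReal.ofReal_mul (prod_abs_rpow_nonneg _ y)]

theorem lintegral_indicator_weight_insertCoord (A : Fin (n + 1) → ℝ)
    {S : Set (EuclideanSpace ℝ (Fin (n + 1)))} (hS : MeasurableSet S)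
    (y : EuclideanSpace ℝ (Fin n)) :
    ∫⁻ t, S.indicator (weight A) (insertCoord i (t, y)) =
      ENNReal.ofReal (∏ j, |y j| ^ A (i.succAbove j)) *
        ∫⁻ t in {t | insertCoord i (t, y) ∈ S}, ENNReal.ofReal (|t| ^ A i) := by
  have hm : MeasurableSet {t | insertCoord i (t, y) ∈ S} :=
    ((continuous_insertCoord i).comp (by fun_prop : Continuous fun t : ℝ => (t, y))).measurable hS
  rw [← lintegral_const_mul' _ _ ENNReal.ofReal_ne_top, ← lintegral_indicator hm]
  refine lintegral_congr fun t => ?_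
  simp only [indicator, mem_ofPred_eq, weight_insertCoord]

theorem setLIntegral_weight_eq {A : Fin (n + 1) → ℝ} (hA : ∀ j, 0 ≤ A j)
    {S : Set (EuclideanSpace ℝ (Fin (n + 1)))} (hS : MeasurableSet S) :
    ∫⁻ x in S, weight A x =
      ∫⁻ y : EuclideanSpace ℝ (Fin n), ∫⁻ t, S.indicator (weight A) (insertCoord i (t, y)) := by
  rw [← lintegral_indicator hS,
    lintegral_eq_lintegral_insertCoord i ((continuous_weight hA).measurable.indicator hS)]

end Coordinates

/-! ### Euclidean Hausdorff measure and Lipschitz maps -/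

theorem _root_.LipschitzWith.euclideanHausdorffMeasure_image_le {X Y : Type*} [EMetricSpace X]
    [EMetricSpace Y] [MeasurableSpace X] [BorelSpace X] [MeasurableSpace Y] [BorelSpace Y]
    {K : NNReal} {f : X → Y} (hf : LipschitzWith K f) (d : ℕ) (s : Set X) :
    μHE[d] (f '' s) ≤ (K : ℝ≥0∞) ^ d * μHE[d] s := by
  simp only [Measure.euclideanHausdorffMeasure_def, Measure.smul_apply, ENNReal.smul_def,
    smul_eq_mul]
  have := hf.hausdorffMeasure_image_le (d := d) (by positivity) s
  rw [ENNReal.rpow_natCast] at this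
  calc _ ≤ _ := mul_le_mul_right this _
    _ = _ := by ring

/-- Bounds surface integrals over graphs from above without an area formula: on the range of `f`,
Hausdorff measure is dominated by `K ^ d` times the pushforward. -/
theorem _root_.LipschitzWith.setLIntegral_range_le {X Y : Type*} [EMetricSpace X]
    [EMetricSpace Y] [MeasurableSpace X] [BorelSpace X] [MeasurableSpace Y] [BorelSpace Y]
    {K : NNReal} {f : X → Y} (hf : LipschitzWith K f) (d : ℕ) {g : Y → ℝ≥0∞} (hg : Measurable g) :
    ∫⁻ y in range f, g y ∂μHE[d] ≤ (K : ℝ≥0∞) ^ d * ∫⁻ x, g (f x) ∂μHE[d] := by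
  have hle : (μHE[d] : Measure Y).restrict (range f) ≤
      ((K : ℝ≥0∞) ^ d) • (μHE[d] : Measure X).map f := by
    refine Measure.le_iff.2 fun s hs => ?_
    rw [Measure.restrict_apply hs, Measure.smul_apply, smul_eq_mul,
      Measure.map_apply hf.continuous.measurable hs, ← image_preimage_eq_inter_range]
    exact hf.euclideanHausdorffMeasure_image_le d _
  refine (lintegral_mono' hle le_rfl).trans_eq ?_
  rw [lintegral_smul_measure, lintegral_map hg hf.continuous.measurable, smul_eq_mul]

/-- If, for almost every `y`, every value below `F y` is exceeded by `g` somewhere on `E` above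
`y`, then the integral of `F` is at most that of `g` over `E`, for 1-Lipschitz projections. -/
theorem lintegral_le_of_forall_exists_fiber {X : Type*} [EMetricSpace X] [MeasurableSpace X]
    [BorelSpace X] {n : ℕ} {π : X → EuclideanSpace ℝ (Fin n)} (hπ : LipschitzWith 1 π)
    {E : Set X} (hE : MeasurableSet E) {g : X → ℝ} (hg0 : ∀ x, 0 ≤ g x) (hg : Measurable g)
    {F : EuclideanSpace ℝ (Fin n) → ℝ≥0∞} (hF : Measurable F) (hfin : ∀ᵐ y, F y < ⊤)
    (h : ∀ᵐ y, ∀ s : ℝ, 0 ≤ s → ENNReal.ofReal s < F y → ∃ x ∈ E, π x = y ∧ s < g x) :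
    ∫⁻ y, F y ≤ ∫⁻ x in E, ENNReal.ofReal (g x) ∂μHE[n] := by
  have h1 : ∫⁻ y, F y = ∫⁻ y, ENNReal.ofReal (F y).toReal :=
    lintegral_congr_ae (hfin.mono fun y hy => (ENNReal.ofReal_toReal hy.ne).symm)
  -- Layer cake on both sides reduces the claim to comparing superlevel sets.
  rw [h1, lintegral_eq_lintegral_meas_lt _ (.of_forall fun y => ENNReal.toReal_nonneg)
    hF.ennreal_toReal.aemeasurable, lintegral_eq_lintegral_meas_lt _ (.of_forall hg0)
    hg.aemeasurable]
  refine setLIntegral_mono' measurableSet_Ioi fun s hs => ?_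
  calc volume {y | s < (F y).toReal} ≤ volume (π '' ({x | s < g x} ∩ E)) := by
        refine measure_mono_ae ?_
        filter_upwards [h, hfin] with y hy hy' hys
        obtain ⟨x, hxE, hxy, hxs⟩ := hy s (le_of_lt hs)
          ((ENNReal.ofReal_lt_iff_lt_toReal (le_of_lt hs) hy'.ne).2 hys)
        exact ⟨x, ⟨hxs, hxE⟩, hxy⟩
    _ ≤ μHE[n] ({x | s < g x} ∩ E) := by
        rw [← EuclideanSpace.euclideanHausdorffMeasure_eq_volume]
        simpa using hπ.euclideanHausdorffMeasure_image_le n ({x | s < g x} ∩ E)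
    _ = _ := by rw [Measure.restrict_apply' hE]

/-! ### The lower bound -/

/-- `H` stands for either open half-line, and `hfiber` is the one-dimensional estimate on it. -/
theorem setLIntegral_weight_le_of_fiber {n : ℕ} {i : Fin (n + 1)} {A B : Fin (n + 1) → ℝ}
    (hA : ∀ j, 0 ≤ A j) (hB : ∀ j, 0 ≤ B j) (hij : ∀ j, j ≠ i → A j = B j) (hi : A i = B i + 1)
    {Ω : Set (EuclideanSpace ℝ (Fin (n + 1)))} (hΩ : IsOpen Ω) (hfin : weightedVolume B Ω ≠ ⊤)
    {H : Set ℝ} (hH : MeasurableSet H)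
    (hfiber : ∀ O : Set ℝ, IsOpen O → ∀ s : ℝ, 0 ≤ s →
      ∫⁻ t in O ∩ H, ENNReal.ofReal (|t| ^ (A i - 1)) ≠ ⊤ →
      ENNReal.ofReal s <
        ENNReal.ofReal (A i) * ∫⁻ t in O ∩ H, ENNReal.ofReal (|t| ^ (A i - 1)) →
      ∃ t ∈ frontier O, t ∈ H ∧ s < |t| ^ A i) :
    ENNReal.ofReal (A i) * ∫⁻ x in Ω ∩ {x | x i ∈ H}, weight B x ≤
      ∫⁻ x in frontier Ω ∩ {x | x i ∈ H}, weight A x ∂μHE[n] := by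
  have hHm : MeasurableSet {x : EuclideanSpace ℝ (Fin (n + 1)) | x i ∈ H} :=
    (by fun_prop : Continuous fun x : EuclideanSpace ℝ (Fin (n + 1)) => x i).measurable hH
  have hS := hΩ.measurableSet.inter hHm
  have hSfin : ∫⁻ x in Ω ∩ {x | x i ∈ H}, weight B x ≠ ⊤ :=
    ne_top_of_le_ne_top hfin (lintegral_mono_set inter_subset_left)
  have hmeas : Measurable fun y : EuclideanSpace ℝ (Fin n) =>
      ∫⁻ t, (Ω ∩ {x | x i ∈ H}).indicator (weight B) (insertCoord i (t, y)) :=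
    Measurable.lintegral_prod_left' (μ := volume)
      (((continuous_weight hB).measurable.indicator hS).comp (continuous_insertCoord i).measurable)
  -- Finite total volume makes almost every slice finite, as the one-dimensional estimate requires.
  have hae := ae_lt_top hmeas (by rwa [← setLIntegral_weight_eq i hB hS])
  have hBA : ∀ j, B (i.succAbove j) = A (i.succAbove j) := fun j =>
    (hij _ (Fin.succAbove_ne i j)).symm
  have hBi : B i = A i - 1 := by linarith
  rw [setLIntegral_weight_eq i hB hS, ← lintegral_const_mul _ hmeas]
  refine lintegral_le_of_forall_exists_fiber (lipschitzWith_removeCoord i)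
    (isClosed_frontier.measurableSet.inter hHm) (prod_abs_rpow_nonneg A)
    (continuous_prod_abs_rpow hA).measurable (hmeas.const_mul _)
    (hae.mono fun y hy => ENNReal.mul_lt_top ENNReal.ofReal_lt_top hy) ?_
  filter_upwards [hae] with y hy s hs hlt
  have hcont : Continuous fun t : ℝ => insertCoord i (t, y) :=
    (continuous_insertCoord i).comp (by fun_prop)
  rw [lintegral_indicator_weight_insertCoord i B hS] at hy hlt
  simp only [hBA, hBi] at hy hlt
  have hset : {t | insertCoord i (t, y) ∈ Ω ∩ {x | x i ∈ H}} =
      (fun t => insertCoord i (t, y)) ⁻¹' Ω ∩ H := by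
    ext t; simp
  rw [hset] at hy hlt
  set W := ∏ j, |y j| ^ A (i.succAbove j) with hW
  have hWpos : 0 < W := by
    refine lt_of_le_of_ne (prod_abs_rpow_nonneg (fun j => A (i.succAbove j)) y) fun h0 => ?_
    rw [← h0] at hlt
    simp at hlt
  have hW0 : ENNReal.ofReal W ≠ 0 := by simpa using hWpos
  -- On this line the weight is `W * |t| ^ A i`, so the level `s` becomes `s / W`.
  obtain ⟨t, ht, htH, hst⟩ := hfiber _ (hΩ.preimage hcont) (s / W) (div_nonneg hs hWpos.le)
    (fun h => by rw [h, ENNReal.mul_top hW0] at hy; exact lt_irrefl _ hy)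
    (by
      rw [ENNReal.ofReal_div_of_pos hWpos]
      refine ENNReal.div_lt_of_lt_mul' ?_
      rwa [mul_left_comm])
  -- A frontier point of the slice is a frontier point of `Ω`.
  refine ⟨insertCoord i (t, y), ⟨hcont.frontier_preimage_subset Ω ht, by simpa using htH⟩,
    by simp, ?_⟩
  rw [prod_abs_rpow_insertCoord]
  exact (div_lt_iff₀ hWpos).1 hst

/-- The half-space estimates add up because they use disjoint pieces of the frontier; the hyperplane
`x_i = 0` carries no volume. -/
theorem ofReal_mul_weightedVolume_le {n : ℕ} {i : Fin (n + 1)} {A B : Fin (n + 1) → ℝ}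
    (hA : ∀ j, 0 ≤ A j) (hB : ∀ j, 0 ≤ B j) (hij : ∀ j, j ≠ i → A j = B j) (hi : A i = B i + 1)
    {Ω : Set (EuclideanSpace ℝ (Fin (n + 1)))} (hΩ : IsOpen Ω) (hfin : weightedVolume B Ω ≠ ⊤) :
    ENNReal.ofReal (A i) * weightedVolume B Ω ≤ ∫⁻ x in frontier Ω, weight A x ∂μHE[n] := by
  have hAi : 1 ≤ A i := by linarith [hB i]
  have hm (H : Set ℝ) (hH : MeasurableSet H) :
      MeasurableSet {x : EuclideanSpace ℝ (Fin (n + 1)) | x i ∈ H} :=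
    (by fun_prop : Continuous fun x : EuclideanSpace ℝ (Fin (n + 1)) => x i).measurable hH
  have hdisj (S : Set (EuclideanSpace ℝ (Fin (n + 1)))) :
      Disjoint (S ∩ {x | x i ∈ Ioi (0 : ℝ)}) (S ∩ {x | x i ∈ Iio (0 : ℝ)}) := by
    rw [disjoint_left]
    rintro x ⟨_, hx⟩ ⟨_, hx'⟩
    exact lt_asymm (show 0 < x i from hx) hx'
  have hnull : volume {x : EuclideanSpace ℝ (Fin (n + 1)) | x i = 0} = 0 := by
    have hms : MeasurableSet {x : EuclideanSpace ℝ (Fin (n + 1)) | x i = 0} :=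
      hm {0} (measurableSet_singleton 0)
    rw [← lintegral_indicator_one hms,
      lintegral_eq_lintegral_insertCoord i (measurable_one.indicator hms)]
    refine lintegral_eq_zero_of_ae_eq_zero (.of_forall fun y => ?_)
    refine lintegral_eq_zero_of_ae_eq_zero ?_
    filter_upwards [Measure.ae_ne volume (0 : ℝ)] with t ht
    simp [indicator, ht]
  have hvol : weightedVolume B Ω ≤ (∫⁻ x in Ω ∩ {x | x i ∈ Ioi (0 : ℝ)}, weight B x) +
      ∫⁻ x in Ω ∩ {x | x i ∈ Iio (0 : ℝ)}, weight B x := by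
    rw [← lintegral_union (hΩ.measurableSet.inter (hm _ measurableSet_Iio)) (hdisj Ω)]
    refine lintegral_mono_set' ?_
    have : ∀ᵐ x : EuclideanSpace ℝ (Fin (n + 1)), x i ≠ 0 := by
      rw [ae_iff]; simpa using hnull
    filter_upwards [this] with x hx hxΩ
    rcases lt_or_gt_of_ne hx with h | h
    · exact Or.inr ⟨hxΩ, h⟩
    · exact Or.inl ⟨hxΩ, h⟩
  calc ENNReal.ofReal (A i) * weightedVolume B Ω
      ≤ ENNReal.ofReal (A i) * (∫⁻ x in Ω ∩ {x | x i ∈ Ioi (0 : ℝ)}, weight B x) +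
        ENNReal.ofReal (A i) * ∫⁻ x in Ω ∩ {x | x i ∈ Iio (0 : ℝ)}, weight B x := by
        rw [← mul_add]; gcongr
    _ ≤ (∫⁻ x in frontier Ω ∩ {x | x i ∈ Ioi (0 : ℝ)}, weight A x ∂μHE[n]) +
        ∫⁻ x in frontier Ω ∩ {x | x i ∈ Iio (0 : ℝ)}, weight A x ∂μHE[n] :=
      add_le_add
        (setLIntegral_weight_le_of_fiber hA hB hij hi hΩ hfin measurableSet_Ioi
          fun O hO s hs => exists_frontier_pos hAi hO hs)
        (setLIntegral_weight_le_of_fiber hA hB hij hi hΩ hfin measurableSet_Iio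
          fun O hO s hs => exists_frontier_neg hAi hO hs)
    _ ≤ _ := by
      rw [← lintegral_union (isClosed_frontier.measurableSet.inter (hm _ measurableSet_Iio))
        (hdisj _)]
      exact lintegral_mono_set (union_subset inter_subset_left inter_subset_left)

/-! ### The upper bound -/

/-- The derivative is bounded through `2|u| ≤ u² + 1 ≤ exp (u²)`. -/
theorem lipschitzWith_exp_neg_sq : LipschitzWith 1 fun u : ℝ => Real.exp (-u ^ 2) := by
  have hd (u : ℝ) : HasDerivAt (fun u : ℝ => Real.exp (-u ^ 2))
      (Real.exp (-u ^ 2) * -(2 * u)) u := by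
    simpa using ((hasDerivAt_pow 2 u).neg).exp
  refine lipschitzWith_of_nnnorm_deriv_le (fun u => (hd u).differentiableAt) fun u => ?_
  rw [(hd u).deriv, ← NNReal.coe_le_coe, coe_nnnorm, NNReal.coe_one, norm_mul, Real.norm_eq_abs,
    Real.norm_eq_abs, abs_of_pos (Real.exp_pos _), Real.exp_neg, inv_mul_le_one₀ (Real.exp_pos _)]
  have h1 := Real.add_one_le_exp (u ^ 2)
  rw [abs_neg]
  exact abs_le.2 ⟨by nlinarith [sq_nonneg (u + 1)], by nlinarith [sq_nonneg (u - 1)]⟩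

/-- The Gaussian height `δ exp(-|y|²)`. -/
noncomputable def height {n : ℕ} (δ : ℝ) (y : EuclideanSpace ℝ (Fin n)) : ℝ := δ * Real.exp (-‖y‖ ^ 2)

/-- The thin symmetric neighbourhood `{|x_i| < δ exp(-|y|²)}` of the hyperplane `x_i = 0`, where `y`
collects the other coordinates. -/
def thinDomain {n : ℕ} (i : Fin (n + 1)) (δ : ℝ) : Set (EuclideanSpace ℝ (Fin (n + 1))) :=
  {x | (x i) ^ 2 - height δ (removeCoord i x) ^ 2 < 0}

theorem height_pos {n : ℕ} {δ : ℝ} (hδ : 0 < δ) (y : EuclideanSpace ℝ (Fin n)) :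
    0 < height δ y := mul_pos hδ (Real.exp_pos _)

theorem contDiff_height {n : ℕ} (δ : ℝ) :
    ContDiff ℝ ∞ (height δ : EuclideanSpace ℝ (Fin n) → ℝ) :=
  contDiff_const.mul (contDiff_norm_sq ℝ).neg.exp

theorem lipschitzWith_height {n : ℕ} (δ : NNReal) :
    LipschitzWith δ (height δ : EuclideanSpace ℝ (Fin n) → ℝ) := by
  have h := (lipschitzWith_exp_neg_sq.comp
    (lipschitzWith_one_norm (E := EuclideanSpace ℝ (Fin n))))
  refine LipschitzWith.of_dist_le_mul fun x y => ?_
  have := h.dist_le_mul x y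
  simp only [mul_one, NNReal.coe_one, one_mul, Function.comp_apply] at this
  rw [height, height, Real.dist_eq, ← mul_sub, abs_mul, abs_of_nonneg δ.coe_nonneg]
  exact mul_le_mul_of_nonneg_left this δ.2

section ThinDomain

variable {n : ℕ} (i : Fin (n + 1))

/-- The constant `√(1 + K²)` is relaxed to `1 + K`, which still tends to 1 as `K → 0`. -/
theorem lipschitzWith_insertCoord_graph {K : NNReal} {f : EuclideanSpace ℝ (Fin n) → ℝ}
    (hf : LipschitzWith K f) : LipschitzWith (1 + K) fun y => insertCoord i (f y, y) := by
  refine LipschitzWith.of_dist_le_mul fun y z => ?_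
  have hd := hf.dist_le_mul y z
  rw [Real.dist_eq] at hd
  have h0 : (0 : ℝ) ≤ K * dist y z := by positivity
  have hn := norm_sq_eq_add_removeCoord i (insertCoord i (f y, y) - insertCoord i (f z, z))
  have hr : removeCoord i (insertCoord i (f y, y) - insertCoord i (f z, z)) = y - z := by
    ext j; simp
  rw [hr, ← dist_eq_norm, ← dist_eq_norm] at hn
  simp only [PiLp.sub_apply, insertCoord_same] at hn
  refine abs_le_of_sq_le_sq' ?_ (by positivity) |>.2
  rw [hn, NNReal.coe_add, NNReal.coe_one]
  have h1 : (f y - f z) ^ 2 ≤ (K * dist y z) ^ 2 := sq_le_sq' (by linarith [(abs_le.1 hd).1])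
    (abs_le.1 hd).2
  have h2 : 0 ≤ dist y z * (K * dist y z) := by positivity
  nlinarith

theorem contDiff_thinDomain_function (δ : ℝ) :
    ContDiff ℝ ∞ fun x : EuclideanSpace ℝ (Fin (n + 1)) =>
      (x i) ^ 2 - height δ (removeCoord i x) ^ 2 :=
  ((by fun_prop : ContDiff ℝ ∞ fun x : EuclideanSpace ℝ (Fin (n + 1)) => x i).pow 2).sub
    (((contDiff_height δ).comp (contDiff_removeCoord i)).pow 2)

theorem isOpen_thinDomain (δ : ℝ) : IsOpen (thinDomain i δ) :=
  isOpen_lt (contDiff_thinDomain_function i δ).continuous continuous_const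

theorem sq_eq_of_mem_frontier_thinDomain {δ : ℝ} {p : EuclideanSpace ℝ (Fin (n + 1))}
    (hp : p ∈ frontier (thinDomain i δ)) : (p i) ^ 2 = height δ (removeCoord i p) ^ 2 := by
  have : (p i) ^ 2 - height δ (removeCoord i p) ^ 2 = 0 :=
    frontier_lt_subset_eq (contDiff_thinDomain_function i δ).continuous continuous_const hp
  linarith

/-- The `i`-th partial derivative of the defining function is `2 * p i`, nonzero on the frontier
because there `(p i)²` is the square of a positive height. -/
theorem isSmoothOpen_thinDomain {δ : ℝ} (hδ : 0 < δ) : IsSmoothOpen (thinDomain i δ) := by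
  refine ⟨isOpen_thinDomain i δ, fun p hp => ⟨univ, _, isOpen_univ, mem_univ p,
    (contDiff_thinDomain_function i δ).contDiffOn, fun h0 => ?_, fun x _ => Iff.rfl⟩⟩
  have hpi : p i ≠ 0 := fun h => by
    have := sq_eq_of_mem_frontier_thinDomain i hp
    rw [h] at this
    nlinarith [height_pos hδ (removeCoord i p)]
  set e : EuclideanSpace ℝ (Fin (n + 1)) := EuclideanSpace.single i 1
  have hF := ((contDiff_thinDomain_function i δ).differentiable (by simp) p).hasFDerivAt
  rw [h0] at hF
  have hline := (hF.hasLineDerivAt e)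
  rw [HasLineDerivAt] at hline
  have hfun : (fun t : ℝ => ((p + t • e) i) ^ 2 - height δ (removeCoord i (p + t • e)) ^ 2) =
      fun t : ℝ => (p i + t) ^ 2 - height δ (removeCoord i p) ^ 2 := by
    funext t
    have hr : removeCoord i (p + t • e) = removeCoord i p := by
      ext j; simp [e]
    rw [hr]; simp [e]
  rw [hfun] at hline
  have hder : HasDerivAt (fun t : ℝ => (p i + t) ^ 2 - height δ (removeCoord i p) ^ 2)
      (2 * p i) 0 := by
    simpa using (((hasDerivAt_id (0 : ℝ)).const_add (p i)).pow 2).sub_const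
      (height δ (removeCoord i p) ^ 2)
  have := hder.unique hline
  simp at this
  exact hpi this

theorem frontier_thinDomain_subset (δ : ℝ) :
    frontier (thinDomain i δ) ⊆ range (fun y => insertCoord i (height δ y, y)) ∪
      range (fun y => insertCoord i (-height δ y, y)) := by
  intro p hp
  rcases sq_eq_sq_iff_eq_or_eq_neg.1 (sq_eq_of_mem_frontier_thinDomain i hp) with h | h
  · exact Or.inl ⟨removeCoord i p, by simp only [← h, insertCoord_removeCoord]⟩
  · exact Or.inr ⟨removeCoord i p, by simp only [← h, insertCoord_removeCoord]⟩

theorem setLIntegral_frontier_thinDomain_le {A : Fin (n + 1) → ℝ} (hA : ∀ j, 0 ≤ A j)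
    (δ : NNReal) :
    ∫⁻ x in frontier (thinDomain i δ), weight A x ∂μHE[n] ≤
      ((1 + δ : NNReal) : ℝ≥0∞) ^ n * (2 * ∫⁻ y : EuclideanSpace ℝ (Fin n),
        ENNReal.ofReal (∏ j, |y j| ^ A (i.succAbove j)) *
          ENNReal.ofReal (height (δ : ℝ) y ^ A i)) := by
  have hw := (continuous_weight hA).measurable
  have hh (y : EuclideanSpace ℝ (Fin n)) : |height (δ : ℝ) y| = height (δ : ℝ) y :=
    abs_of_nonneg (mul_nonneg δ.2 (Real.exp_pos _).le)
  have h1 := (lipschitzWith_insertCoord_graph i (lipschitzWith_height δ)).setLIntegral_range_le n hw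
  have h2 := (lipschitzWith_insertCoord_graph i
    (lipschitzWith_height δ).neg).setLIntegral_range_le n hw
  simp only [weight_insertCoord, Pi.neg_apply, abs_neg, hh,
    EuclideanSpace.euclideanHausdorffMeasure_eq_volume] at h1 h2
  calc _ ≤ _ := lintegral_mono_set (frontier_thinDomain_subset i δ)
    _ ≤ _ := lintegral_union_le _ _ _
    _ ≤ _ := add_le_add h1 h2
    _ = _ := by ring

/-- The right side is exactly the integral in `setLIntegral_frontier_thinDomain_le`, so the
perimeter and `A i` times the volume compare up to `(1 + δ) ^ n`. -/
theorem ofReal_mul_weightedVolume_thinDomain {A B : Fin (n + 1) → ℝ}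
    (hB : ∀ j, 0 ≤ B j) (hij : ∀ j, j ≠ i → A j = B j) (hi : A i = B i + 1) {δ : ℝ} (hδ : 0 < δ) :
    ENNReal.ofReal (A i) * weightedVolume B (thinDomain i δ) =
      2 * ∫⁻ y : EuclideanSpace ℝ (Fin n),
        ENNReal.ofReal (∏ j, |y j| ^ A (i.succAbove j)) *
          ENNReal.ofReal (height δ y ^ A i) := by
  have hBA : ∀ j, B (i.succAbove j) = A (i.succAbove j) := fun j =>
    (hij _ (Fin.succAbove_ne i j)).symm
  have hBi : B i = A i - 1 := by linarith
  rw [weightedVolume, setLIntegral_weight_eq i hB (isOpen_thinDomain i δ).measurableSet,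
    ← lintegral_const_mul' _ _ ENNReal.ofReal_ne_top, ← lintegral_const_mul' _ _ (by simp)]
  refine lintegral_congr fun y => ?_
  rw [lintegral_indicator_weight_insertCoord i B (isOpen_thinDomain i δ).measurableSet]
  have hset : {t : ℝ | insertCoord i (t, y) ∈ thinDomain i δ} =
      Ioo (-height δ y) (height δ y) := by
    ext t
    simp only [thinDomain, mem_ofPred_eq, insertCoord_same, removeCoord_insertCoord, mem_Ioo,
      sub_neg]
    rw [sq_lt_sq, abs_of_pos (height_pos hδ y), abs_lt]
  simp only [hset, hBA, hBi]
  rw [mul_left_comm, lintegral_Ioo_neg_rpow (by linarith [hB i]) (height_pos hδ y).le]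
  ring

theorem lintegral_height_pos {α : Fin n → ℝ} (hα : ∀ j, 0 ≤ α j) (a : ℝ) {δ : ℝ} (hδ : 0 < δ) :
    0 < ∫⁻ y : EuclideanSpace ℝ (Fin n), ENNReal.ofReal (∏ j, |y j| ^ α j) *
      ENNReal.ofReal (height δ y ^ a) := by
  have hcont : Continuous fun y : EuclideanSpace ℝ (Fin n) => ∏ j, |y j| ^ α j :=
    continuous_prod_abs_rpow hα
  have hm : Measurable fun y : EuclideanSpace ℝ (Fin n) => ENNReal.ofReal (∏ j, |y j| ^ α j) *
      ENNReal.ofReal (height δ y ^ a) :=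
    hcont.measurable.ennreal_ofReal.mul
      ((contDiff_height δ).continuous.measurable.pow_const a).ennreal_ofReal
  rw [lintegral_pos_iff_support hm]
  have hopen : IsOpen {y : EuclideanSpace ℝ (Fin n) | 0 < ∏ j, |y j| ^ α j} :=
    isOpen_lt continuous_const hcont
  refine (hopen.measure_pos volume ⟨WithLp.toLp 2 fun _ => 1, by simp⟩).trans_le
    (measure_mono fun y hy => ?_)
  have : 0 < height δ y ^ a := Real.rpow_pos_of_pos (height_pos hδ y) a
  simpa using ⟨hy, this⟩

theorem lintegral_height_lt_top {α : Fin n → ℝ} (hα : ∀ j, 0 ≤ α j) {a : ℝ} (ha : 0 < a) {δ : ℝ}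
    (hδ : 0 < δ) :
    ∫⁻ y : EuclideanSpace ℝ (Fin n), ENNReal.ofReal (∏ j, |y j| ^ α j) *
      ENNReal.ofReal (height δ y ^ a) < ⊤ := by
  have h1 (j : Fin n) : Integrable fun t : ℝ => |t| ^ α j * Real.exp (-a * t ^ 2) := by
    -- The exponent is rounded up to a natural number so that the real power at negative `t` is an
    -- ordinary power, with absolute value `|t| ^ ⌈α j⌉₊`.
    have hk := (integrable_rpow_mul_exp_neg_mul_sq ha (s := (⌈α j⌉₊ : ℝ))
      (neg_one_lt_zero.trans_le (Nat.cast_nonneg _))).norm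
    refine ((integrable_exp_neg_mul_sq ha).add hk).mono' ?_ (.of_forall fun t => ?_)
    · exact (((Real.continuous_rpow_const (hα j)).comp continuous_abs).mul
        (by fun_prop)).aestronglyMeasurable
    have hle : |t| ^ α j ≤ 1 + |t| ^ ⌈α j⌉₊ := by
      rcases le_total |t| 1 with h | h
      · linarith [Real.rpow_le_one (abs_nonneg t) h (hα j), pow_nonneg (abs_nonneg t) ⌈α j⌉₊]
      · have := Real.rpow_le_rpow_of_exponent_le h (Nat.le_ceil (α j))
        rw [Real.rpow_natCast] at this
        linarith
    have hexp := Real.exp_pos (-a * t ^ 2)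
    simp only [Pi.add_apply, norm_mul, Real.norm_eq_abs, Real.rpow_natCast, abs_pow,
      abs_of_pos hexp, abs_of_nonneg (Real.rpow_nonneg (abs_nonneg t) (α j))]
    nlinarith
  have h2 : Integrable fun y : EuclideanSpace ℝ (Fin n) =>
      δ ^ a * ∏ j, (|y j| ^ α j * Real.exp (-a * y j ^ 2)) := by
    refine Integrable.const_mul ?_ _
    exact (PiLp.volume_preserving_ofLp (Fin n)).integrable_comp_of_integrable
      (Integrable.fintype_prod h1)
  refine lt_of_eq_of_lt (lintegral_congr fun y => ?_) h2.lintegral_lt_top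
  rw [← ENNReal.ofReal_mul (prod_abs_rpow_nonneg α y), height,
    Real.mul_rpow hδ.le (Real.exp_pos _).le, ← Real.exp_mul, Finset.prod_mul_distrib,
    ← Real.exp_sum, EuclideanSpace.norm_sq_eq]
  congr 1
  simp only [Real.norm_eq_abs, sq_abs]
  rw [← Finset.mul_sum, neg_mul_comm, mul_comm _ (-a)]
  ring

end ThinDomain

theorem isoConst_eq {n : ℕ} {i : Fin (n + 1)} {A B : Fin (n + 1) → ℝ}
    (hA : ∀ j, 0 ≤ A j) (hB : ∀ j, 0 ≤ B j) (hij : ∀ j, j ≠ i → A j = B j) (hi : A i = B i + 1) :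
    isoConst A B = ENNReal.ofReal (A i) := by
  have hAi : 0 < A i := by linarith [hB i]
  have hsum : ∑ j, A j = ∑ j, B j + 1 := by
    rw [Fin.sum_univ_succAbove A i, Fin.sum_univ_succAbove B i, hi,
      Finset.sum_congr rfl fun j _ => hij _ (Fin.succAbove_ne i j)]
    ring
  -- The numerator and denominator of the exponent coincide and are positive, so the exponent is 1.
  have hquot (Ω : Set (EuclideanSpace ℝ (Fin (n + 1)))) : quotient A B Ω =
      (∫⁻ x in frontier Ω, weight A x ∂μHE[n]) / weightedVolume B Ω := by
    have hpos : 0 < ((n + 1 : ℕ) : ℝ) + ∑ j, B j :=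
      add_pos_of_pos_of_nonneg (by positivity) (Finset.sum_nonneg fun j _ => hB j)
    rw [quotient, hsum, ← add_assoc, add_sub_cancel_right, div_self hpos.ne', ENNReal.rpow_one]
    rfl
  refine le_antisymm ?_ (le_sInf ?_)
  · have hbound (δ : NNReal) (hδ : 0 < δ) :
        isoConst A B ≤ ((1 + δ : NNReal) : ℝ≥0∞) ^ n * ENNReal.ofReal (A i) := by
      have hδ' : (0 : ℝ) < δ := hδ
      have hvol := ofReal_mul_weightedVolume_thinDomain i hB hij hi hδ'
      have hpos : 0 < ENNReal.ofReal (A i) * weightedVolume B (thinDomain i δ) := by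
        rw [hvol]
        exact ENNReal.mul_pos (by simp) (lintegral_height_pos (fun j => hA _) _ hδ').ne'
      have hfin : ENNReal.ofReal (A i) * weightedVolume B (thinDomain i δ) < ⊤ := by
        rw [hvol]
        exact ENNReal.mul_lt_top (by simp) (lintegral_height_lt_top (fun j => hA _) hAi hδ')
      have hV0 : 0 < weightedVolume B (thinDomain i δ) :=
        pos_iff_ne_zero.2 fun h => by simp [h] at hpos
      have hVtop : weightedVolume B (thinDomain i δ) < ⊤ :=
        lt_top_iff_ne_top.2 fun h => by
          rw [h, ENNReal.mul_top (by simpa using hAi)] at hfin; exact lt_irrefl _ hfin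
      have hle : isoConst A B ≤ quotient A B (thinDomain i δ) :=
        sInf_le ⟨thinDomain i δ, isSmoothOpen_thinDomain i hδ', hV0, hVtop, rfl⟩
      refine hle.trans ?_
      rw [hquot, ENNReal.div_le_iff hV0.ne' hVtop.ne, mul_assoc, hvol]
      exact setLIntegral_frontier_thinDomain_le i hA δ
    have hlim : Filter.Tendsto
        (fun δ : NNReal => ((1 + δ : NNReal) : ℝ≥0∞) ^ n * ENNReal.ofReal (A i))
        (nhdsWithin 0 (Ioi 0)) (nhds (ENNReal.ofReal (A i))) := by
      have hc : Filter.Tendsto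
          (fun δ : NNReal => (((1 + δ) ^ n * (A i).toNNReal : NNReal) : ℝ≥0∞))
          (nhdsWithin 0 (Ioi 0)) (nhds (((1 + 0) ^ n * (A i).toNNReal : NNReal) : ℝ≥0∞)) :=
        ENNReal.tendsto_coe.2 ((by fun_prop : Continuous fun δ : NNReal =>
          (1 + δ) ^ n * (A i).toNNReal).tendsto 0 |>.mono_left nhdsWithin_le_nhds)
      simpa [ENNReal.ofReal] using hc
    exact ge_of_tendsto hlim (eventually_mem_nhdsWithin.mono fun δ hδ => hbound δ hδ)
  · rintro q ⟨Ω, hΩ, h0, htop, rfl⟩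
    rw [hquot, ENNReal.le_div_iff_mul_le (Or.inl h0.ne') (Or.inl htop.ne)]
    exact ofReal_mul_weightedVolume_le hA hB hij hi hΩ.1 htop.ne

end MonomialIsoperimetry

theorem theorem2 (N : ℕ) (hN : 2 ≤ N) (A B : Fin N → ℝ)
    (hA : ∀ j, 0 ≤ A j) (hB : ∀ j, 0 ≤ B j)
    (i : Fin N) (hij : ∀ j, j ≠ i → A j = B j) (hi : A i = B i + 1) :
    MonomialIsoperimetry.isoConst A B = ENNReal.ofReal (A i) := by
  obtain ⟨n, rfl⟩ : ∃ n, N = n + 1 := ⟨N - 1, by omega⟩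
  exact MonomialIsoperimetry.isoConst_eq hA hB hij hi
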